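/- Let $(R,\mathfrak m,k)$ be a Cohen–Macaulay (Noetherian) local ring of dimension one. For a nonzero finitely generated $R$-module $M$ put $\operatorname{type}_R(M)=\dim_k\operatorname{Ext}_R^{\dim M}(k,M)$. An ideal $I$ of $R$ is called an Elias ideal if it is $\mathfrak m$-primary and $\operatorname{type}_R(I)=\operatorname{type}_R(R/I)$. A canonical module of $R$ is a maximal Cohen–Macaulay $R$-module of type one and finite injective dimension; a canonical ideal of $R$ is an ideal which is isomorphic, as an $R$-module, to a canonical module of $R$. The order $\operatorname{ord}(x)\in\mathbb N\cup\{\infty\}$ of an element $x\in R$ is the supremum of all $a\ge 0$ with $x\in\mathfrak m^a$, and the order $\operatorname{ord}(I)$ of an ideal $I$ is the minimum of the orders of its elements. For ideals $K,I$ write $K:I=\{r\in R: rI\subseteq K\}$. Then: 1. Every proper ideal of $R$ that is isomorphic, as an $R$-module, to $R$ or to a canonical module of $R$ is Elias. 2. If $I$ is an Elias ideal and $J\subseteq I$ is an $\mathfrak m$-primary ideal, then $J$ is Elias. 3. Let $K$ be a canonical ideal and $I$ an ideal with $K\subseteq I$. Then $I$ is Elias if and only if $K\subseteq\mathfrak m(K:I)$.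 4. Let $K$ be a canonical ideal and $I$ an ideal with $K\subseteq I$. Then $K:I$ is Elias if and only if $K\subseteq\mathfrak m I$. 5. Let $I$ be an ideal containing a canonical ideal $K$ with $\operatorname{ord}(K)=1$. Then $I$ is Elias if and only if $I=K$. -/

import Mathlib

universe u

open CategoryTheory IsLocalRing

namespace EliasIdeals

section Modules

variable (R : Type u) [CommRing R] [IsLocalRing R] (M : Type u) [AddCommGroup M] [Module R M]

/-- The `R`-module `Ext^n_R(k, M)`, where `k` is the residue field of the local ring `R`. -/
abbrev ExtResidue (n : ℕ) : Type u :=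
  Abelian.Ext (ModuleCat.of R (ResidueField R)) (ModuleCat.of R M) n

/-- `Ext^n_R(k, M)` is killed by the maximal ideal. -/
theorem extResidue_isTorsionBySet (n : ℕ) :
    Module.IsTorsionBySet R (ExtResidue R M n) (maximalIdeal R : Set R) := by
  rintro e ⟨r, hr⟩
  have hzero : r • 𝟙 (ModuleCat.of R (ResidueField R)) = 0 := by
    ext x
    change r • x = 0
    have hx : algebraMap R (ResidueField R) r = 0 := by
      rw [ResidueField.algebraMap_eq]
      exact (residue_eq_zero_iff r).mpr hr
    rw [Algebra.smul_def, hx, zero_mul]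
  have h1 : r • e = (r • Abelian.Ext.mk₀ (𝟙 (ModuleCat.of R (ResidueField R)))).comp e
      (zero_add n) := by
    rw [Abelian.Ext.smul_comp, Abelian.Ext.mk₀_id_comp]
  change r • e = 0
  rw [h1, ← Abelian.Ext.mk₀_smul, hzero, Abelian.Ext.mk₀_zero, Abelian.Ext.zero_comp]

/-- The vector space structure of `Ext^n_R(k, M)` over the residue field `k = R ⧸ 𝔪`: the class of
`r` acts as `r`. -/
noncomputable abbrev extResidueModule (n : ℕ) : Module (ResidueField R) (ExtResidue R M n) :=
  (extResidue_isTorsionBySet R M n).module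

/-- `dim_k Ext^n_R(k, M)`. It is finite when `R` is Noetherian and `M` is finitely generated. -/
noncomputable def bassNumber (n : ℕ) : ℕ :=
  letI := extResidueModule R M n
  Module.finrank (ResidueField R) (ExtResidue R M n)

/-- The dimension of `M`, that is, the Krull dimension of its support, as a natural number (used
for nonzero finitely generated modules over Noetherian local rings, where it is one). -/
noncomputable def dim : ℕ :=
  ((Module.supportDim R M).unbotD 0).toNat

/-- The (Cohen-Macaulay) type of `M`, `dim_k Ext^{dim M}_R(k, M)`. -/
noncomputable def type : ℕ :=
  bassNumber R M (dim R M)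

/-- `M` is a maximal Cohen-Macaulay `R`-module: it is finitely generated and has a regular sequence
in the maximal ideal whose length is the dimension of `R`, i.e. `depth M = dim R`. (The
definition of a regular sequence includes that `M` is nonzero.) -/
def IsMaximalCohenMacaulay : Prop :=
  Module.Finite R M ∧ ∃ rs : List R, (∀ r ∈ rs, r ∈ maximalIdeal R) ∧
    RingTheory.Sequence.IsRegular M rs ∧ (rs.length : WithBot ℕ∞) = ringKrullDim R

/-- A canonical module of a Cohen-Macaulay local ring: a maximal Cohen-Macaulay module of type one
and of finite injective dimension. -/
def IsCanonicalModule : Prop :=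
  IsMaximalCohenMacaulay R M ∧ type R M = 1 ∧
    ∃ n : ℕ, HasInjectiveDimensionLE (ModuleCat.of R M) n

end Modules

section Ideals

variable {R : Type u} [CommRing R] [IsLocalRing R]

variable (R) in
/-- A Noetherian local ring which is Cohen-Macaulay of dimension one. -/
structure IsCohenMacaulayDimOne : Prop where
  noetherian : IsNoetherianRing R
  dim_eq_one : ringKrullDim R = 1
  cohenMacaulay : IsMaximalCohenMacaulay R R

/-- `I` is primary to the maximal ideal `𝔪`; as `𝔪` is maximal, this means that `√I = 𝔪`. -/
def IsMPrimary (I : Ideal R) : Prop :=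
  I.radical = maximalIdeal R

/-- An Elias ideal: an `𝔪`-primary ideal `I` such that `I` and `R ⧸ I` have the same type. -/
def IsElias (I : Ideal R) : Prop :=
  IsMPrimary I ∧ type R I = type R (R ⧸ I)

/-- A canonical ideal: an ideal which, as a module, is a canonical module of `R`. -/
def IsCanonicalIdeal (K : Ideal R) : Prop :=
  IsCanonicalModule R K

/-- The `𝔪`-adic order of an element: the largest `a` with `x ∈ 𝔪 ^ a`, or `∞` if there is
no largest one. -/
noncomputable def elementOrder (x : R) : ℕ∞ :=
  ⨆ (a : ℕ) (_ : x ∈ maximalIdeal R ^ a), (a : ℕ∞)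

/-- The order of an ideal: the minimum of the orders of its elements. -/
noncomputable def idealOrder (I : Ideal R) : ℕ∞ :=
  ⨅ x ∈ I, elementOrder x

end Ideals

end EliasIdeals

/-!
Let `z` be a nonzerodivisor in an `𝔪`-primary ideal `I`. The type of `R ⧸ I` is the length of
`Hom(k, R ⧸ I)`. The type of `I` is the length of `Ext¹(k, I)`, which is isomorphic to
`Hom(k, I ⧸ z I)` because `Hom(k, I) = 0` and `z` kills `Ext¹(k, I)`. Multiplication by `z` embeds
the first module in the second one, so `type (R ⧸ I) ≤ type I`, and comparing socle elements shows
that `I` is Elias if and only if `z I : 𝔪 ⊆ z R`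
(`EliasIdeals.IsCohenMacaulayDimOne.isElias_iff`). In terms of fractional ideals the condition is
`I : 𝔪 ⊆ R`; it is inherited by smaller ideals and is immediate for `I = x R`. A proper canonical
ideal is Elias because `0 < type (R ⧸ K) ≤ type K = 1`.

The statements about an ideal `I` between a canonical ideal `K` and `R` rest on duality. A module
`K` of finite injective dimension has `Ext^i(N, K) = 0` for `i ≥ 2` and `N` of finite length
(`EliasIdeals.IsCohenMacaulayDimOne.extVanishes_of_hasInjectiveDimensionLE`), while
`Ext¹(k, K) ≠ 0` as `K` has type one. Hence for ideals `I < I'` containing a nonzerodivisor some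
linear map `I → K` does not extend to `I'`. Fractions are avoided by working with `L = z K` for a
nonzerodivisor `z ∈ I`: then `L : I` is `Hom(I, K)`, and it follows that `L : (L : I) = I`
(`EliasIdeals.IsCanonicalIdeal.colon_colon`). Taking `I = z R` gives `z K : K = z R`, so that `K` is
faithful, and faithfulness together with one more vanishing of `Ext¹` shows that `K` contains a
nonzerodivisor. Consequently `K : (K : I) = I` for every ideal `I ⊇ K`.

For a nonzerodivisor `y ∈ 𝔪 K` and `L = y K` one computes `y I : 𝔪 = L : 𝔪 (K : I)` and
`y R = L : K`, so by duality `y I : 𝔪 ⊆ y R` is equivalent to `K ⊆ 𝔪 (K : I)`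
(`EliasIdeals.IsCanonicalIdeal.isElias_iff`). Applying this to `K : I` gives the criterion for
`K : I`. If `I ≠ K` then `K : I ⊆ 𝔪`, so an Elias ideal `I` with `K < I` forces `K ⊆ 𝔪²`, which is
impossible for `K` of order one.
-/

namespace EliasIdeals


/-! ### Nonzerodivisors, finite length and socles -/

section CommutativeAlgebra

theorem isSMulRegular_ideal {R : Type*} [CommRing R] {x : R} (hx : x ∈ nonZeroDivisors R)
    (I : Ideal R) :
    IsSMulRegular I x := by
  intro a b hab
  ext
  have h : x * (a : R) = x * b := congrArg Subtype.val hab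
  exact (mul_cancel_left_mem_nonZeroDivisors hx).mp h

variable {R : Type u} [CommRing R] [IsLocalRing R]

theorem IsCohenMacaulayDimOne.exists_mem_nonZeroDivisors (hR : IsCohenMacaulayDimOne R) :
    ∃ x ∈ maximalIdeal R, x ∈ nonZeroDivisors R := by
  obtain ⟨-, rs, hmem, hreg, hlen⟩ := hR.cohenMacaulay
  rw [hR.dim_eq_one] at hlen
  match rs, hlen with
  | [], h => simp at h
  | x :: _, _ =>
    refine ⟨x, hmem x (by simp), ?_⟩
    have h : IsSMulRegular R x := ((RingTheory.Sequence.isRegular_cons_iff R x _).mp hreg).1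
    rw [mem_nonZeroDivisors_iff_right]
    intro y hy
    exact h (by simpa [mul_comm] using hy)

theorem IsCohenMacaulayDimOne.isArtinianRing_quotient (hR : IsCohenMacaulayDimOne R) {z : R}
    (hz : z ∈ nonZeroDivisors R) {I : Ideal R} (hzI : z ∈ I) : IsArtinianRing (R ⧸ I) := by
  have := hR.noetherian
  have h1 : ringKrullDim (R ⧸ Ideal.span {z}) ≤ 0 := by
    have := ringKrullDim_quotient_succ_le_of_nonZeroDivisor hz
    rw [hR.dim_eq_one] at this
    generalize ringKrullDim (R ⧸ Ideal.span {z}) = d at this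
    induction d with
    | bot => simp
    | coe d =>
      induction d with
      | top => exact absurd this (by decide)
      | coe d =>
        have h2 : d + 1 ≤ 1 := by exact_mod_cast this
        have h3 : d ≤ 0 := by omega
        exact_mod_cast h3
  have h2 : Ring.KrullDimLE 0 (R ⧸ Ideal.span {z}) := by
    rwa [Ring.KrullDimLE, Order.krullDimLE_iff]
  have h3 : IsArtinianRing (R ⧸ Ideal.span {z}) :=
    isArtinianRing_iff_isNoetherianRing_krullDimLE_zero.mpr ⟨inferInstance, h2⟩
  exact (Ideal.Quotient.factor_surjective
    ((Ideal.span_singleton_le_iff_mem I).mpr hzI)).isArtinianRing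

theorem IsCohenMacaulayDimOne.isFiniteLength_quotient (hR : IsCohenMacaulayDimOne R) {z : R}
    (hz : z ∈ nonZeroDivisors R) {I : Ideal R} (hzI : z ∈ I) : IsFiniteLength R (R ⧸ I) := by
  have := hR.noetherian
  have := hR.isArtinianRing_quotient hz hzI
  rw [← Module.length_ne_top_iff,
    Module.length_eq_of_surjective (R := R ⧸ I) (S := R) (M := R ⧸ I) Ideal.Quotient.mk_surjective]
  exact Module.length_ne_top

theorem IsCohenMacaulayDimOne.isMPrimary_of_mem (hR : IsCohenMacaulayDimOne R) {z : R}
    (hz : z ∈ nonZeroDivisors R) {I : Ideal R} (hzI : z ∈ I) (hI : I ≠ ⊤) : IsMPrimary I := by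
  have := hR.isArtinianRing_quotient hz hzI
  refine le_antisymm ?_ ?_
  · exact (Ideal.radical_mono (le_maximalIdeal hI)).trans
      (Ideal.IsPrime.radical (inferInstance : (maximalIdeal R).IsPrime)).le
  · rw [Ideal.radical_eq_sInf]
    refine le_sInf fun P ⟨hIP, hP⟩ => ?_
    have hm : (P.map (Ideal.Quotient.mk I)).IsPrime :=
      Ideal.map_isPrime_of_surjective Ideal.Quotient.mk_surjective (by simpa using hIP)
    have hm' := IsArtinianRing.isMaximal_of_isPrime (P.map (Ideal.Quotient.mk I))
    have h2 := Ideal.comap_isMaximal_of_surjective (Ideal.Quotient.mk I)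
      Ideal.Quotient.mk_surjective (K := P.map (Ideal.Quotient.mk I))
    rw [Ideal.comap_map_of_surjective _ Ideal.Quotient.mk_surjective] at h2
    have h3 : P ⊔ Ideal.comap (Ideal.Quotient.mk I) ⊥ = P := by
      rw [sup_eq_left, ← RingHom.ker_eq_comap_bot, Ideal.mk_ker]; exact hIP
    rw [h3] at h2
    exact (eq_maximalIdeal h2).ge

theorem IsMPrimary.ne_top {I : Ideal R} (hI : IsMPrimary I) : I ≠ ⊤ := by
  rintro rfl
  exact (maximalIdeal.isMaximal R).ne_top (hI.symm.trans (by simp))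

theorem IsCohenMacaulayDimOne.exists_mem_nonZeroDivisors_of_isMPrimary
    (hR : IsCohenMacaulayDimOne R) {I : Ideal R} (hI : IsMPrimary I) :
    ∃ z ∈ I, z ∈ nonZeroDivisors R := by
  obtain ⟨x, hxm, hx⟩ := hR.exists_mem_nonZeroDivisors
  rw [← hI] at hxm
  obtain ⟨n, hn⟩ := hxm
  exact ⟨x ^ n, hn, pow_mem hx n⟩

variable {M : Type*} [AddCommGroup M] [Module R M]

/-- The linear map `k → M` sending `1` to an element `a` killed by the maximal ideal. -/
noncomputable def residueHom (a : M) (ha : ∀ r ∈ maximalIdeal R, r • a = 0) :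
    ResidueField R →ₗ[R] M :=
  (maximalIdeal R).liftQ (LinearMap.toSpanSingleton R M a) (fun r hr => by simpa using ha r hr)

@[simp]
theorem residueHom_one (a : M) (ha : ∀ r ∈ maximalIdeal R, r • a = 0) :
    residueHom a ha 1 = a := by
  change (LinearMap.toSpanSingleton R M a) 1 = a
  simp

theorem residueHom_ext {f g : ResidueField R →ₗ[R] M} (h : f 1 = g 1) : f = g := by
  ext x
  obtain ⟨r, rfl⟩ := residue_surjective x
  have : residue R r = r • (1 : ResidueField R) := by
    rw [Algebra.smul_def, mul_one, ResidueField.algebraMap_eq]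
  rw [this, map_smul, map_smul, h]

theorem smul_residueHom_one (f : ResidueField R →ₗ[R] M) {r : R} (hr : r ∈ maximalIdeal R) :
    r • f 1 = 0 := by
  rw [← map_smul, Algebra.smul_def, mul_one, ResidueField.algebraMap_eq,
    (residue_eq_zero_iff r).mpr hr, map_zero]

theorem residueHom_injective {a : M} (ha : ∀ r ∈ maximalIdeal R, r • a = 0) (h0 : a ≠ 0) :
    Function.Injective (residueHom a ha) := by
  rw [injective_iff_map_eq_zero]
  intro x hx
  obtain ⟨r, rfl⟩ := residue_surjective x
  by_contra hr
  rw [residue_eq_zero_iff, mem_maximalIdeal, mem_nonunits_iff, not_not] at hr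
  have : residue R r = r • (1 : ResidueField R) := by
    rw [Algebra.smul_def, mul_one, ResidueField.algebraMap_eq]
  rw [this, map_smul, residueHom_one] at hx
  exact h0 ((hr.smul_eq_zero).mp hx)

theorem smul_eq_zero_of_isSimpleModule [IsSimpleModule R M] {r : R} (hr : r ∈ maximalIdeal R)
    (a : M) : r • a = 0 := by
  obtain ⟨J, hJ, ⟨e⟩⟩ := isSimpleModule_iff_quot_maximal.mp (inferInstance : IsSimpleModule R M)
  have hJ' := eq_maximalIdeal hJ
  subst hJ'
  apply e.injective
  rw [map_smul, map_zero]
  obtain ⟨b, hb⟩ := Ideal.Quotient.mk_surjective (e a)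
  rw [← hb, Algebra.smul_def, Ideal.Quotient.algebraMap_eq, ← map_mul]
  exact Ideal.Quotient.eq_zero_iff_mem.mpr (Ideal.mul_mem_right _ _ hr)

/-- A nonzero module of finite length has a nonzero socle element. -/
theorem exists_socle_of_isFiniteLength (hM : IsFiniteLength R M) [Nontrivial M] :
    ∃ a : M, a ≠ 0 ∧ ∀ r ∈ maximalIdeal R, r • a = 0 := by
  have := (isFiniteLength_iff_isNoetherian_isArtinian.mp hM).2
  obtain ⟨S, hS⟩ := IsAtomic.exists_atom (Submodule R M)
  have := isSimpleModule_iff_isAtom.mpr hS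
  obtain ⟨a, haS, ha⟩ := Submodule.exists_mem_ne_zero_of_ne_bot hS.1
  exact ⟨a, ha, fun r hr =>
    congrArg Subtype.val (smul_eq_zero_of_isSimpleModule (M := S) hr ⟨a, haS⟩)⟩

end CommutativeAlgebra


/-! ### Vanishing of Ext and extension of linear maps -/

section ExtSequences

variable {R : Type u} [CommRing R]

/-- `Ext^n_R(A, M) = 0`, for modules in the universe of `R`. -/
abbrev ExtVanishes (A M : Type u) [AddCommGroup A] [Module R A] [AddCommGroup M] [Module R M]
    (n : ℕ) : Prop :=
  Subsingleton (Abelian.Ext (ModuleCat.of R A) (ModuleCat.of R M) n)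

variable {A B C : Type u} [AddCommGroup A] [Module R A] [AddCommGroup B] [Module R B]
  [AddCommGroup C] [Module R C] {M : Type u} [AddCommGroup M] [Module R M]

/-- A short exact sequence of modules, as a short complex in the category of modules. -/
abbrev shortComplex (f : A →ₗ[R] B) (g : B →ₗ[R] C) (h : Function.Exact f g) :
    ShortComplex (ModuleCat.{u} R) :=
  ModuleCat.shortComplexOfCompEqZero f g h.linearMap_comp_eq_zero

theorem shortExact_shortComplex {f : A →ₗ[R] B} {g : B →ₗ[R] C} (h : Function.Exact f g)
    (hf : Function.Injective f) (hg : Function.Surjective g) :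
    (shortComplex f g h).ShortExact where
  exact := ModuleCat.shortComplex_exact _ h
  mono_f := (ModuleCat.mono_iff_injective _).mpr hf
  epi_g := (ModuleCat.epi_iff_surjective _).mpr hg

theorem ExtVanishes.congr {n : ℕ} (e : A ≃ₗ[R] B) (h : ExtVanishes (R := R) A M n) :
    ExtVanishes (R := R) B M n := by
  refine ⟨fun x y => ?_⟩
  have key (x : Abelian.Ext (ModuleCat.of R B) (ModuleCat.of R M) n) : x = 0 := by
    have h1 := h.elim ((Abelian.Ext.mk₀ e.toModuleIso.hom).comp x (zero_add n)) 0
    have h2 := congrArg (fun t => (Abelian.Ext.mk₀ e.toModuleIso.inv).comp t (zero_add n)) h1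
    simpa only [Abelian.Ext.mk₀_comp_mk₀_assoc, Iso.inv_hom_id, Abelian.Ext.mk₀_id_comp,
      Abelian.Ext.comp_zero] using h2
  rw [key x, key y]

theorem extVanishes_self (n : ℕ) : ExtVanishes (R := R) R M (n + 1) :=
  Abelian.Ext.subsingleton_of_projective _ _ _

theorem ExtVanishes.of_subsingleton [Subsingleton A] (n : ℕ) : ExtVanishes (R := R) A M n := by
  refine ⟨fun x y => ?_⟩
  have h0 : 𝟙 (ModuleCat.of R A) = 0 := by
    ext a; exact Subsingleton.elim (α := A) _ _
  rw [← Abelian.Ext.mk₀_id_comp x, ← Abelian.Ext.mk₀_id_comp y, h0, Abelian.Ext.mk₀_zero,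
    Abelian.Ext.zero_comp, Abelian.Ext.zero_comp]

/-- Exactness of `Ext^n(B, M) → Ext^n(A, M) → Ext^(n+1)(C, M)` for `0 → A → B → C → 0`. -/
theorem ExtVanishes.left {f : A →ₗ[R] B} {g : B →ₗ[R] C} (h : Function.Exact f g)
    (hf : Function.Injective f) (hg : Function.Surjective g) {n : ℕ}
    (hB : ExtVanishes (R := R) B M n) (hC : ExtVanishes (R := R) C M (n + 1)) :
    ExtVanishes (R := R) A M n := by
  have key (x : Abelian.Ext (ModuleCat.of R A) (ModuleCat.of R M) n) : x = 0 := by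
    obtain ⟨y, hy⟩ := Abelian.Ext.contravariant_sequence_exact₁ (shortExact_shortComplex h hf hg) _
      x (add_comm 1 n) (hC.elim _ _)
    rw [← hy, hB.elim y 0, Abelian.Ext.comp_zero]
  exact ⟨fun x y => by rw [key x, key y]⟩

/-- Exactness of `Ext^n(C, M) → Ext^n(B, M) → Ext^n(A, M)` for `0 → A → B → C → 0`. -/
theorem ExtVanishes.middle {f : A →ₗ[R] B} {g : B →ₗ[R] C} (h : Function.Exact f g)
    (hf : Function.Injective f) (hg : Function.Surjective g) {n : ℕ}
    (hA : ExtVanishes (R := R) A M n) (hC : ExtVanishes (R := R) C M n) :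
    ExtVanishes (R := R) B M n := by
  have key (x : Abelian.Ext (ModuleCat.of R B) (ModuleCat.of R M) n) : x = 0 := by
    obtain ⟨y, hy⟩ := Abelian.Ext.contravariant_sequence_exact₂ (shortExact_shortComplex h hf hg) _
      x (hA.elim _ _)
    rw [← hy, hC.elim y 0, Abelian.Ext.comp_zero]
  exact ⟨fun x y => by rw [key x, key y]⟩

/-- Exactness of `Ext^n(A, M) → Ext^(n+1)(C, M) → Ext^(n+1)(B, M)` for `0 → A → B → C → 0`. -/
theorem ExtVanishes.right {f : A →ₗ[R] B} {g : B →ₗ[R] C} (h : Function.Exact f g)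
    (hf : Function.Injective f) (hg : Function.Surjective g) {n : ℕ}
    (hA : ExtVanishes (R := R) A M n) (hB : ExtVanishes (R := R) B M (n + 1)) :
    ExtVanishes (R := R) C M (n + 1) := by
  have key (x : Abelian.Ext (ModuleCat.of R C) (ModuleCat.of R M) (n + 1)) : x = 0 := by
    obtain ⟨y, hy⟩ := Abelian.Ext.contravariant_sequence_exact₃ (shortExact_shortComplex h hf hg) _
      x (hB.elim _ _) (add_comm 1 n)
    rw [← hy, hA.elim y 0, Abelian.Ext.comp_zero]
  exact ⟨fun x y => by rw [key x, key y]⟩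

/-- If `Ext¹(C, M) = 0` then maps to `M` extend along an injection with cokernel `C`. -/
theorem exists_extension_of_extVanishes {f : A →ₗ[R] B} {g : B →ₗ[R] C} (h : Function.Exact f g)
    (hf : Function.Injective f) (hg : Function.Surjective g)
    (hC : ExtVanishes (R := R) C M 1) (φ : A →ₗ[R] M) : ∃ ψ : B →ₗ[R] M, ψ ∘ₗ f = φ := by
  obtain ⟨y, hy⟩ := Abelian.Ext.contravariant_sequence_exact₁ (shortExact_shortComplex h hf hg)
    (ModuleCat.of R M) (Abelian.Ext.mk₀ (ModuleCat.ofHom φ)) (add_comm 1 0) (hC.elim _ _)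
  obtain ⟨ψ, rfl⟩ := (Abelian.Ext.mk₀_bijective _ _).2 y
  rw [Abelian.Ext.mk₀_comp_mk₀] at hy
  have h1 := (Abelian.Ext.mk₀_bijective _ _).1 hy
  exact ⟨ψ.hom, by simpa using congrArg ModuleCat.Hom.hom h1⟩

/-- If maps to `M` extend along an injection `A → B` with cokernel `C` and `Ext¹(B, M) = 0`, then
`Ext¹(C, M) = 0`. -/
theorem extVanishes_of_exists_extension {f : A →ₗ[R] B} {g : B →ₗ[R] C} (h : Function.Exact f g)
    (hf : Function.Injective f) (hg : Function.Surjective g) (hB : ExtVanishes (R := R) B M 1)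
    (hext : ∀ φ : A →ₗ[R] M, ∃ ψ : B →ₗ[R] M, ψ ∘ₗ f = φ) : ExtVanishes (R := R) C M 1 := by
  have hS := shortExact_shortComplex h hf hg
  have key (x : Abelian.Ext (ModuleCat.of R C) (ModuleCat.of R M) 1) : x = 0 := by
    obtain ⟨y, hy⟩ := Abelian.Ext.contravariant_sequence_exact₃ hS _
      x (hB.elim _ _) (add_comm 1 0)
    obtain ⟨φ, rfl⟩ := (Abelian.Ext.mk₀_bijective _ _).2 y
    obtain ⟨ψ, hψ⟩ := hext φ.hom
    have h1 : φ = (shortComplex f g h).f ≫ ModuleCat.ofHom ψ := by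
      ext1; exact hψ.symm
    rw [← hy, h1, ← Abelian.Ext.mk₀_comp_mk₀, hS.extClass_comp_assoc]
  exact ⟨fun x y => by rw [key x, key y]⟩

end ExtSequences

/-! ### Modules of finite injective dimension -/

section FiniteInjectiveDimension

variable {R : Type u} [CommRing R] [IsLocalRing R] {M : Type u} [AddCommGroup M] [Module R M]

/-- For modules of finite length, the vanishing of `Ext^n(-, M)` can be tested on the residue
field. -/
theorem extVanishes_of_isFiniteLength {n : ℕ} (hk : ExtVanishes (R := R) (ResidueField R) M n)
    {N : Type u} [AddCommGroup N] [Module R N] (hN : IsFiniteLength R N) :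
    ExtVanishes (R := R) N M n := by
  induction hN with
  | of_subsingleton => exact ExtVanishes.of_subsingleton n
  | @of_simple_quotient P _ _ N' _ _ ih =>
    refine ExtVanishes.middle (LinearMap.exact_subtype_mkQ N') N'.injective_subtype
      N'.mkQ_surjective ih ?_
    obtain ⟨J, hJ, ⟨e⟩⟩ :=
      isSimpleModule_iff_quot_maximal.mp (inferInstance : IsSimpleModule R (P ⧸ N'))
    obtain rfl := eq_maximalIdeal hJ
    exact ExtVanishes.congr (A := ResidueField R) e.symm hk

/-- Over a one-dimensional Cohen-Macaulay local ring, a module `M` of finite injective dimension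
satisfies `Ext^i(N, M) = 0` for all `i ≥ 2` and all `N` of finite length. For a nonzerodivisor `x`,
the residue field embeds in `R ⧸ (x)`, which has projective dimension one; this makes a descending
induction on `i` work. -/
theorem IsCohenMacaulayDimOne.extVanishes_of_hasInjectiveDimensionLE
    (hR : IsCohenMacaulayDimOne R) {d : ℕ} (hM : HasInjectiveDimensionLE (ModuleCat.of R M) d)
    (i : ℕ) {N : Type u} [AddCommGroup N] [Module R N] (hN : IsFiniteLength R N) :
    ExtVanishes (R := R) N M (i + 2) := by
  obtain ⟨x, hxm, hx⟩ := hR.exists_mem_nonZeroDivisors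
  obtain h | h := le_or_gt (d + 1) (i + 2)
  · exact HasInjectiveDimensionLT.subsingleton _ (d + 1) (i + 2) h _
  -- descending induction on `i`, starting from the injective dimension of `M`
  obtain ⟨j, hj⟩ : ∃ j, i + j = d := ⟨d - i, by omega⟩
  clear h
  induction j generalizing i N with
  | zero => exact HasInjectiveDimensionLT.subsingleton _ (d + 1) (i + 2) (by omega) _
  | succ j ih =>
    refine extVanishes_of_isFiniteLength ?_ hN
    set J : Ideal R := Ideal.span {x}
    have hfl : IsFiniteLength R (R ⧸ J) :=
      hR.isFiniteLength_quotient hx (Ideal.mem_span_singleton_self x)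
    have hJ : J ≠ ⊤ := by
      intro h
      exact (mem_maximalIdeal x).mp hxm (Ideal.span_singleton_eq_top.mp h)
    have : Nontrivial (R ⧸ J) := Ideal.Quotient.nontrivial_iff.mpr hJ
    have hquot : ExtVanishes (R := R) (R ⧸ J) M (i + 2) := by
      have hex : Function.Exact (LinearMap.lsmul R R x) J.mkQ := by
        intro a
        rw [← LinearMap.mem_ker, Submodule.ker_mkQ, Ideal.mem_span_singleton']
        simp [mul_comm]
      exact ExtVanishes.right hex
        (fun a b hab => (mul_cancel_left_mem_nonZeroDivisors hx).mp hab)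
        J.mkQ_surjective (extVanishes_self i) (extVanishes_self (i + 1))
    obtain ⟨a, ha0, ha⟩ := exists_socle_of_isFiniteLength hfl
    exact ExtVanishes.left (LinearMap.exact_map_mkQ_range (residueHom a ha))
      (residueHom_injective ha ha0) (Submodule.mkQ_surjective _) hquot
      (ih (i + 1) (hfl.of_surjective (Submodule.mkQ_surjective _)) (by omega))

end FiniteInjectiveDimension


/-! ### Duality with respect to a canonical ideal -/

section CanonicalIdeals

variable {R : Type u} [CommRing R] [IsLocalRing R]

/-- Every nonzero ideal has dimension one. -/
theorem IsCohenMacaulayDimOne.dim_ideal (hR : IsCohenMacaulayDimOne R) {I : Ideal R} (hI : I ≠ ⊥) :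
    dim R I = 1 := by
  have := hR.noetherian
  have : Nontrivial I := (Submodule.nontrivial_iff_ne_bot).mpr hI
  obtain ⟨x, hxm, hx⟩ := hR.exists_mem_nonZeroDivisors
  have h1 := Module.supportDim_quotSMulTop_succ_eq_supportDim (isSMulRegular_ideal hx I) hxm
  have hle : Module.supportDim R I ≤ 1 :=
    (Module.supportDim_le_ringKrullDim R I).trans hR.dim_eq_one.le
  have hnt : Nontrivial (QuotSMulTop x I) := by
    refine Submodule.Quotient.nontrivial_iff.mpr fun h => ?_
    have := Submodule.eq_bot_of_le_smul_of_le_jacobson_bot (Ideal.span {x}) (⊤ : Submodule R I)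
      (Module.Finite.fg_top) (by rw [Submodule.ideal_span_singleton_smul, h])
      ((Ideal.span_singleton_le_iff_mem _).mpr (by rwa [jacobson_eq_maximalIdeal _ bot_ne_top]))
    exact top_ne_bot this
  have hge : (0 : WithBot ℕ∞) ≤ Module.supportDim R (QuotSMulTop x I) := by
    have := Module.supportDim_ne_bot_of_nontrivial R (QuotSMulTop x I)
    generalize Module.supportDim R (QuotSMulTop x I) = d at this
    induction d with
    | bot => exact absurd rfl this
    | coe d => exact_mod_cast (zero_le : (0 : ℕ∞) ≤ d)
  have heq : Module.supportDim R I = 1 := by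
    refine le_antisymm hle ?_
    rw [← h1]
    exact (by simpa using add_le_add_left hge 1)
  rw [dim, heq]
  rfl

theorem IsCanonicalIdeal.ne_bot {K : Ideal R} (hK : IsCanonicalIdeal K) : K ≠ ⊥ := by
  obtain ⟨⟨-, rs, -, hreg, -⟩, -, -⟩ := hK
  exact Submodule.nontrivial_iff_ne_bot.mp hreg.nontrivial

theorem IsCanonicalIdeal.bassNumber_one (hR : IsCohenMacaulayDimOne R) {K : Ideal R}
    (hK : IsCanonicalIdeal K) : bassNumber R K 1 = 1 := by
  have h := hK.2.1
  rwa [type, hR.dim_ideal hK.ne_bot] at h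

theorem IsCanonicalIdeal.not_extVanishes_one (hR : IsCohenMacaulayDimOne R) {K : Ideal R}
    (hK : IsCanonicalIdeal K) : ¬ ExtVanishes (R := R) (ResidueField R) K 1 := by
  intro h
  have h1 := hK.bassNumber_one hR
  rw [bassNumber] at h1
  let := extResidueModule R K 1
  have : Subsingleton (ExtResidue R K 1) := h
  rw [Module.finrank_zero_of_subsingleton] at h1
  exact zero_ne_one h1

theorem IsCanonicalIdeal.extVanishes_two (hR : IsCohenMacaulayDimOne R) {K : Ideal R}
    (hK : IsCanonicalIdeal K) {N : Type u} [AddCommGroup N] [Module R N]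
    (hN : IsFiniteLength R N) : ExtVanishes (R := R) N K 2 := by
  obtain ⟨-, -, d, hd⟩ := hK
  exact hR.extVanishes_of_hasInjectiveDimensionLE hd 0 hN

/-- If two ideals `I < I'` contain a nonzerodivisor, some linear map `I → K` to a canonical ideal
does not extend to `I'`. -/
theorem IsCanonicalIdeal.exists_not_extends (hR : IsCohenMacaulayDimOne R) {K : Ideal R}
    (hK : IsCanonicalIdeal K) {z : R} (hz : z ∈ nonZeroDivisors R) {I I' : Ideal R} (hzI : z ∈ I)
    (h : I < I') :
    ∃ φ : I →ₗ[R] K, ∀ ψ : I' →ₗ[R] K, ψ ∘ₗ Submodule.inclusion h.le ≠ φ := by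
  by_contra! hcon
  -- otherwise `Ext¹(I' ⧸ I, K) = 0`, although the residue field embeds in `I' ⧸ I`
  set N : Submodule R I' := Submodule.comap I'.subtype I
  have hI' : ExtVanishes (R := R) I' K 1 :=
    ExtVanishes.left (LinearMap.exact_subtype_mkQ I') I'.injective_subtype I'.mkQ_surjective
      (extVanishes_self 0) (hK.extVanishes_two hR (hR.isFiniteLength_quotient hz (h.le hzI)))
  have hQ : ExtVanishes (R := R) (I' ⧸ N) K 1 := by
    refine extVanishes_of_exists_extension (f := Submodule.inclusion h.le) (g := N.mkQ) ?_
      (Submodule.inclusion_injective _) N.mkQ_surjective hI' hcon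
    rw [LinearMap.exact_iff, Submodule.ker_mkQ, Submodule.range_inclusion]
  have hfl : IsFiniteLength R (I' ⧸ N) := by
    refine (hR.isFiniteLength_quotient hz hzI).of_injective
      (f := N.mapQ I I'.subtype le_rfl) ?_
    rw [← LinearMap.ker_eq_bot, Submodule.ker_mapQ, Submodule.mkQ_map_self]
  have : Nontrivial (I' ⧸ N) := by
    obtain ⟨a, haI', haI⟩ := SetLike.exists_of_lt h
    refine Submodule.Quotient.nontrivial_iff.mpr fun hN => haI ?_
    have : (⟨a, haI'⟩ : I') ∈ N := hN ▸ Submodule.mem_top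
    exact this
  obtain ⟨a, ha0, ha⟩ := exists_socle_of_isFiniteLength hfl
  exact hK.not_extVanishes_one hR <|
    ExtVanishes.left (LinearMap.exact_map_mkQ_range (residueHom a ha))
      (residueHom_injective ha ha0) (Submodule.mkQ_surjective _) hQ
      (hK.extVanishes_two hR (hfl.of_surjective (Submodule.mkQ_surjective _)))

/-- Division by a nonzerodivisor `z`: if `I c ⊆ z K` then `y ↦ y c / z` is a linear map `I → K`. -/
theorem exists_linearMap_of_mem_colon {R : Type*} [CommRing R] {z c : R}
    (hz : z ∈ nonZeroDivisors R) {I K : Ideal R}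
    (hc : c ∈ (Ideal.span {z} * K).colon (I : Set R)) :
    ∃ ψ : I →ₗ[R] K, ∀ y : I, z * (ψ y : R) = y * c := by
  have h (y : I) : ∃ w : K, z * (w : R) = y * c := by
    obtain ⟨w, hw, hwy⟩ := Ideal.mem_span_singleton_mul.mp (Submodule.mem_colon.mp hc y y.2)
    exact ⟨⟨w, hw⟩, by rw [hwy, smul_eq_mul, mul_comm]⟩
  choose ψ hψ using h
  refine ⟨{ toFun := ψ, map_add' := fun a b => ?_, map_smul' := fun r a => ?_ }, hψ⟩
  · refine Subtype.ext ((mul_cancel_left_mem_nonZeroDivisors hz).mp ?_)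
    simp only [Submodule.coe_add, mul_add, hψ, add_mul]
  · refine Subtype.ext ((mul_cancel_left_mem_nonZeroDivisors hz).mp ?_)
    simp only [RingHom.id_apply, SetLike.val_smul, smul_eq_mul, hψ, mul_left_comm z r, mul_assoc]

/-- Canonical duality, for `L = z K` with `z` a nonzerodivisor in `I`. As `z ∈ I`, a linear map
`φ : I → K` is `y ↦ y c / z` with `c = φ z`, so that `L : I` is the module of linear maps `I → K`,
and these maps detect strict inclusions of ideals. -/
theorem IsCanonicalIdeal.colon_colon (hR : IsCohenMacaulayDimOne R) {K : Ideal R}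
    (hK : IsCanonicalIdeal K) {z : R} (hz : z ∈ nonZeroDivisors R) {I : Ideal R} (hzI : z ∈ I) :
    (Ideal.span {z} * K).colon
      ((Ideal.span {z} * K).colon (I : Set R) : Set R) = I := by
  set L := Ideal.span {z} * K
  have hle : I ≤ L.colon (L.colon (I : Set R) : Set R) := fun a ha =>
    Submodule.mem_colon.mpr fun c hc => by
      rw [smul_eq_mul, mul_comm]; exact Submodule.mem_colon.mp hc a ha
  by_contra hne
  obtain ⟨φ, hφ⟩ := hK.exists_not_extends hR hz hzI (lt_of_le_of_ne hle (Ne.symm hne))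
  have hcomm (y : I) : z * (φ y : R) = y * φ ⟨z, hzI⟩ := by
    have h1 : z • φ y = (y : R) • φ ⟨z, hzI⟩ := by
      rw [← map_smul, ← map_smul]
      congr 1
      ext
      simp [mul_comm]
    exact congrArg Subtype.val h1
  have hc : (φ ⟨z, hzI⟩ : R) ∈ L.colon (I : Set R) := Submodule.mem_colon.mpr fun y hy => by
    rw [smul_eq_mul, mul_comm, ← hcomm ⟨y, hy⟩]
    exact Ideal.mul_mem_mul (Ideal.mem_span_singleton_self z) (φ _).2
  obtain ⟨ψ, hψ⟩ := exists_linearMap_of_mem_colon hz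
    (I := L.colon (L.colon (I : Set R) : Set R)) (K := K) (c := (φ ⟨z, hzI⟩ : R))
    (Submodule.mem_colon.mpr fun y hy => by
      rw [smul_eq_mul, mul_comm (φ ⟨z, hzI⟩ : R) y]
      exact Submodule.mem_colon.mp hy _ hc)
  refine hφ ψ (LinearMap.ext fun y => Subtype.ext ?_)
  refine (mul_cancel_left_mem_nonZeroDivisors hz).mp ?_
  rw [hcomm, LinearMap.comp_apply, hψ]
  rfl

theorem colon_span_singleton_mul {R : Type*} [CommRing R] {z : R} (hz : z ∈ nonZeroDivisors R)
    (K : Ideal R) : (Ideal.span {z} * K).colon (Ideal.span {z} : Set R) = K := by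
  ext c
  rw [Submodule.mem_colon]
  constructor
  · intro h
    obtain ⟨w, hw, hwc⟩ := Ideal.mem_span_singleton_mul.mp (h z (Ideal.mem_span_singleton_self z))
    rw [smul_eq_mul, mul_comm c, mul_cancel_left_mem_nonZeroDivisors hz] at hwc
    exact hwc ▸ hw
  · intro hc p hp
    rw [smul_eq_mul, mul_comm c p]
    exact Ideal.mul_mem_mul hp hc

/-- In terms of fractional ideals, `K : K = R`. -/
theorem IsCanonicalIdeal.span_singleton_mul_colon_self (hR : IsCohenMacaulayDimOne R) {K : Ideal R}
    (hK : IsCanonicalIdeal K) {z : R} (hz : z ∈ nonZeroDivisors R) :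
    (Ideal.span {z} * K).colon (K : Set R) = Ideal.span {z} := by
  have := hK.colon_colon hR hz (Ideal.mem_span_singleton_self z)
  rwa [colon_span_singleton_mul hz] at this

/-- A canonical ideal is faithful. -/
theorem IsCanonicalIdeal.eq_zero_of_forall_mul_eq_zero (hR : IsCohenMacaulayDimOne R) {K : Ideal R}
    (hK : IsCanonicalIdeal K) {b : R} (hb : ∀ c ∈ K, b * c = 0) : b = 0 := by
  have := hR.noetherian
  obtain ⟨x, hxm, hx⟩ := hR.exists_mem_nonZeroDivisors
  have hmem : b ∈ (⨅ n : ℕ, Ideal.span {x} ^ n : Ideal R) := by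
    rw [Ideal.mem_iInf]
    intro n
    rw [Ideal.span_singleton_pow, ← hK.span_singleton_mul_colon_self hR (pow_mem hx n)]
    exact Submodule.mem_colon.mpr fun c hc => by
      rw [smul_eq_mul, hb c hc]; exact Submodule.zero_mem _
  rwa [Ideal.iInf_pow_eq_bot_of_isLocalRing _ (fun h =>
    (mem_maximalIdeal x).mp hxm (Ideal.span_singleton_eq_top.mp h)), Ideal.mem_bot] at hmem

/-- A nonzerodivisor `x` acting injectively on a cyclic module `C = R ⧸ J` forces
`Ext¹(C, K) = 0`: multiplication by `x` is surjective on it because `Ext²(C ⧸ x C, K) = 0`. -/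
theorem IsCanonicalIdeal.extVanishes_one_of_regular (hR : IsCohenMacaulayDimOne R) {K : Ideal R}
    (hK : IsCanonicalIdeal K) {x : R} (hxm : x ∈ maximalIdeal R) (hx : x ∈ nonZeroDivisors R)
    {J : Ideal R} (hJ : ∀ a, x * a ∈ J → a ∈ J) : ExtVanishes (R := R) (R ⧸ J) K 1 := by
  have := hR.noetherian
  have hinj : Function.Injective (LinearMap.lsmul R (R ⧸ J) x) := by
    rw [injective_iff_map_eq_zero]
    intro a ha
    obtain ⟨a, rfl⟩ := Ideal.Quotient.mk_surjective a
    rw [LinearMap.lsmul_apply, Algebra.smul_def, Ideal.Quotient.algebraMap_eq, ← map_mul] at ha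
    exact Ideal.Quotient.eq_zero_iff_mem.mpr (hJ a (Ideal.Quotient.eq_zero_iff_mem.mp ha))
  set C := (R ⧸ J) ⧸ LinearMap.range (LinearMap.lsmul R (R ⧸ J) x)
  have hfl : IsFiniteLength R C := by
    let f : (R ⧸ Ideal.span {x}) →ₗ[R] C := (Ideal.span {x}).liftQ
      ((LinearMap.range (LinearMap.lsmul R (R ⧸ J) x)).mkQ ∘ₗ J.mkQ) (by
        rw [Ideal.span_le, Set.singleton_subset_iff]
        change (LinearMap.range (LinearMap.lsmul R (R ⧸ J) x)).mkQ (J.mkQ x) = 0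
        rw [Submodule.mkQ_apply, Submodule.Quotient.mk_eq_zero]
        refine ⟨J.mkQ 1, ?_⟩
        rw [LinearMap.lsmul_apply, ← map_smul, smul_eq_mul, mul_one])
    refine (hR.isFiniteLength_quotient hx (Ideal.mem_span_singleton_self x)).of_surjective
      (f := f) ?_
    rw [← LinearMap.range_eq_top, Submodule.range_liftQ, LinearMap.range_eq_top]
    exact (Submodule.mkQ_surjective _).comp J.mkQ_surjective
  have hS := shortExact_shortComplex
    (LinearMap.exact_map_mkQ_range (LinearMap.lsmul R (R ⧸ J) x)) hinj (Submodule.mkQ_surjective _)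
  have hsurj (e : Abelian.Ext (ModuleCat.of R (R ⧸ J)) (ModuleCat.of R K) 1) :
      ∃ e', x • e' = e := by
    obtain ⟨e', he'⟩ := Abelian.Ext.contravariant_sequence_exact₁ hS _ e (add_comm 1 1)
      ((hK.extVanishes_two hR hfl).elim _ _)
    refine ⟨e', ?_⟩
    rw [← he']
    change _ = (Abelian.Ext.mk₀ (x • 𝟙 (ModuleCat.of R (R ⧸ J)))).comp e' (zero_add 1)
    rw [Abelian.Ext.mk₀_smul, Abelian.Ext.smul_comp, Abelian.Ext.mk₀_id_comp]
  have hbot := Submodule.eq_bot_of_le_smul_of_le_jacobson_bot (Ideal.span {x})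
    (⊤ : Submodule R (Abelian.Ext (ModuleCat.of R (R ⧸ J)) (ModuleCat.of R K) 1))
    Module.Finite.fg_top (fun e _ => by
      obtain ⟨e', rfl⟩ := hsurj e
      exact Submodule.smul_mem_smul (Ideal.mem_span_singleton_self x) Submodule.mem_top)
    ((Ideal.span_singleton_le_iff_mem _).mpr (by rwa [jacobson_eq_maximalIdeal _ bot_ne_top]))
  exact (Submodule.subsingleton_iff R).mp (subsingleton_of_bot_eq_top hbot.symm)

/-- A canonical ideal contains a nonzerodivisor. Let `J = K : xⁿ` be the saturation of `K` with
respect to a nonzerodivisor `x`. Multiplication by `xⁿ` maps `J` to `K`; this map extends to `R`,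
that is, agrees on `J` with multiplication by an element of `K`, which is `xⁿ` by faithfulness. -/
theorem IsCanonicalIdeal.exists_mem_nonZeroDivisors (hR : IsCohenMacaulayDimOne R) {K : Ideal R}
    (hK : IsCanonicalIdeal K) : ∃ z ∈ K, z ∈ nonZeroDivisors R := by
  have := hR.noetherian
  obtain ⟨x, hxm, hx⟩ := hR.exists_mem_nonZeroDivisors
  let J : ℕ →o Ideal R :=
    { toFun := fun n => K.colon {x ^ n}
      monotone' := monotone_nat_of_le_succ fun n a ha => by
        rw [Submodule.mem_colon_singleton, smul_eq_mul] at ha ⊢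
        rw [pow_succ, ← mul_assoc]
        exact K.mul_mem_right x ha }
  obtain ⟨n, hn⟩ := monotone_stabilizes_iff_noetherian.mpr this J
  have hJ (a : R) : a ∈ J n ↔ a * x ^ n ∈ K := Submodule.mem_colon_singleton
  have hsat : ∀ a, x * a ∈ J n → a ∈ J n := fun a ha => by
    rw [hn (n + 1) n.le_succ]
    refine Submodule.mem_colon_singleton.mpr ?_
    rw [hJ] at ha
    rw [smul_eq_mul, show a * x ^ (n + 1) = x * a * x ^ n by ring]
    exact ha
  let φ : J n →ₗ[R] K :=
    (LinearMap.lsmul R R (x ^ n)).restrict fun a ha => by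
      rw [LinearMap.lsmul_apply, smul_eq_mul, mul_comm]; exact (hJ a).mp ha
  obtain ⟨ψ, hψ⟩ := exists_extension_of_extVanishes (LinearMap.exact_subtype_mkQ (J n))
    (J n).injective_subtype (J n).mkQ_surjective
    (hK.extVanishes_one_of_regular hR hxm hx hsat) φ
  have hKJ : K ≤ J n := fun a ha => (hJ a).mpr (K.mul_mem_right _ ha)
  have h0 : x ^ n - ψ 1 = 0 := hK.eq_zero_of_forall_mul_eq_zero hR fun c hc => by
    have h1 : (ψ c : R) = x ^ n * c :=
      congrArg Subtype.val (LinearMap.congr_fun hψ ⟨c, hKJ hc⟩)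
    have h2 : ψ c = c • ψ 1 := by rw [← map_smul, smul_eq_mul, mul_one]
    rw [h2, SetLike.val_smul, smul_eq_mul] at h1
    rw [sub_mul, ← h1, mul_comm c, sub_self]
  exact ⟨x ^ n, by rw [sub_eq_zero.mp h0]; exact (ψ 1).2, pow_mem hx n⟩

end CanonicalIdeals


/-! ### The type of a module -/

section TypeOfModules

variable {R : Type u} [CommRing R] [IsLocalRing R]

/-- The length of a finitely generated module killed by the maximal ideal is its dimension as a
vector space over the residue field. -/
theorem length_eq_finrank_of_isTorsionBySet {V : Type*} [AddCommGroup V] [Module R V]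
    [Module.Finite R V] (h : Module.IsTorsionBySet R V (maximalIdeal R : Set R)) :
    letI : Module (ResidueField R) V := h.module
    Module.length R V = Module.finrank (ResidueField R) V := by
  let : Module (ResidueField R) V := h.module
  have : IsScalarTower R (ResidueField R) V := h.isScalarTower (S := R)
  have : Module.Finite (ResidueField R) V := Module.Finite.of_restrictScalars_finite R _ _
  rw [Module.length_eq_of_surjective (R := ResidueField R) (S := R) (M := V)
    residue_surjective, Module.length_eq_finrank]

variable {M : Type u} [AddCommGroup M] [Module R M]

theorem length_extResidue [IsNoetherianRing R] [Module.Finite R M] (n : ℕ) :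
    Module.length R (ExtResidue R M n) = bassNumber R M n :=
  length_eq_finrank_of_isTorsionBySet (extResidue_isTorsionBySet R M n)

/-- `Ext⁰(k, M)` is the module of linear maps `k → M`. -/
noncomputable def extResidueZeroEquiv : ExtResidue R M 0 ≃ₗ[R] (ResidueField R →ₗ[R] M) :=
  (Abelian.Ext.linearEquiv₀ (R := R)).trans ModuleCat.homLinearEquiv

/-- If `z ∈ 𝔪` is `M`-regular, then `Hom(k, M) = 0`, and the connecting map of
`0 → M → M → M ⧸ z M → 0` is an isomorphism `Ext⁰(k, M ⧸ z M) ≅ Ext¹(k, M)`, since `z` acts as `0`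
on `Ext¹(k, M)`. -/
theorem nonempty_extResidue_one_equiv {z : R} (hzm : z ∈ maximalIdeal R)
    (hz : IsSMulRegular M z) :
    Nonempty (ExtResidue R (QuotSMulTop z M) 0 ≃ₗ[R] ExtResidue R M 1) := by
  have hS : (ModuleCat.smulShortComplex (ModuleCat.of R M) z).ShortExact :=
    IsSMulRegular.smulShortComplex_shortExact hz
  have hzero (e : ExtResidue R M 0) : e = 0 := by
    apply extResidueZeroEquiv.injective
    rw [map_zero]
    refine residueHom_ext (hz ?_)
    simp only [LinearMap.zero_apply, smul_zero]
    exact smul_residueHom_one _ hzm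
  refine ⟨LinearEquiv.ofBijective
    (hS.extClass.postcompOfLinear R (ModuleCat.of R (ResidueField R)) (zero_add 1)) ⟨?_, ?_⟩⟩
  · rw [injective_iff_map_eq_zero]
    intro e he
    obtain ⟨e', rfl⟩ := Abelian.Ext.covariant_sequence_exact₃ _ hS e (zero_add 1) he
    have h0 : e' = 0 := hzero e'
    rw [h0, Abelian.Ext.zero_comp]
  · intro e
    refine Abelian.Ext.covariant_sequence_exact₁ _ hS e ?_ (zero_add 1)
    exact (Abelian.Ext.smul_eq_comp_mk₀ (R := R) (Y := ModuleCat.of R M) e z).symm.trans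
      (@extResidue_isTorsionBySet R _ _ M _ _ 1 e ⟨z, hzm⟩)

theorem length_residueHom [IsNoetherianRing R] [Module.Finite R M] :
    Module.length R (ResidueField R →ₗ[R] M) = bassNumber R M 0 := by
  rw [← length_extResidue, extResidueZeroEquiv.length_eq]

theorem length_residueHom_quotSMulTop [IsNoetherianRing R] [Module.Finite R M] {z : R}
    (hzm : z ∈ maximalIdeal R) (hz : IsSMulRegular M z) :
    Module.length R (ResidueField R →ₗ[R] QuotSMulTop z M) = bassNumber R M 1 := by
  obtain ⟨e⟩ := nonempty_extResidue_one_equiv hzm hz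
  rw [← length_extResidue, ← e.length_eq, extResidueZeroEquiv.length_eq]

theorem bassNumber_congr {N : Type u} [AddCommGroup N] [Module R N] (e : M ≃ₗ[R] N) (n : ℕ) :
    bassNumber R M n = bassNumber R N n := by
  let : Module (ResidueField R) (ExtResidue R M n) := extResidueModule R M n
  let : Module (ResidueField R) (ExtResidue R N n) := extResidueModule R N n
  have : IsScalarTower R (ResidueField R) (ExtResidue R M n) :=
    (extResidue_isTorsionBySet R M n).isScalarTower (S := R)
  have : IsScalarTower R (ResidueField R) (ExtResidue R N n) :=
    (extResidue_isTorsionBySet R N n).isScalarTower (S := R)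
  let f : ExtResidue R M n →ₗ[R] ExtResidue R N n :=
    (Abelian.Ext.mk₀ e.toModuleIso.hom).postcompOfLinear R _ (add_zero n)
  let g : ExtResidue R N n →ₗ[R] ExtResidue R M n :=
    (Abelian.Ext.mk₀ e.toModuleIso.inv).postcompOfLinear R _ (add_zero n)
  have hfg : f ∘ₗ g = LinearMap.id := by
    ext x
    change (x.comp (Abelian.Ext.mk₀ e.toModuleIso.inv) (add_zero n)).comp
      (Abelian.Ext.mk₀ e.toModuleIso.hom) (add_zero n) = x
    rw [Abelian.Ext.comp_assoc_of_third_deg_zero, Abelian.Ext.mk₀_comp_mk₀, Iso.inv_hom_id,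
      Abelian.Ext.comp_mk₀_id]
  have hgf : g ∘ₗ f = LinearMap.id := by
    ext x
    change (x.comp (Abelian.Ext.mk₀ e.toModuleIso.hom) (add_zero n)).comp
      (Abelian.Ext.mk₀ e.toModuleIso.inv) (add_zero n) = x
    rw [Abelian.Ext.comp_assoc_of_third_deg_zero, Abelian.Ext.mk₀_comp_mk₀, Iso.hom_inv_id,
      Abelian.Ext.comp_mk₀_id]
  exact ((LinearEquiv.ofLinearMap f g hfg hgf).extendScalarsOfSurjective
    (S := ResidueField R) residue_surjective).finrank_eq

theorem type_congr {N : Type u} [AddCommGroup N] [Module R N] (e : M ≃ₗ[R] N) :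
    type R M = type R N := by
  rw [type, type, dim, dim, Module.supportDim_eq_of_equiv e, bassNumber_congr e]

theorem IsCanonicalModule.congr {N : Type u} [AddCommGroup N] [Module R N] (e : M ≃ₗ[R] N)
    (hM : IsCanonicalModule R M) : IsCanonicalModule R N := by
  obtain ⟨⟨_, rs, hmem, hreg, hlen⟩, htype, d, hd⟩ := hM
  exact ⟨⟨Module.Finite.equiv e, rs, hmem, (e.isRegular_congr rs).mp hreg, hlen⟩,
    (type_congr e).symm.trans htype, d, hasInjectiveDimensionLT_of_iso e.toModuleIso (d + 1)⟩

end TypeOfModules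


/-! ### A colon criterion for Elias ideals -/

section EliasCriterion

theorem surjective_iff_length_eq {R V W : Type*} [CommRing R] [AddCommGroup V] [Module R V]
    [AddCommGroup W] [Module R W] {f : V →ₗ[R] W} (hf : Function.Injective f)
    (hW : Module.length R W ≠ ⊤) :
    Function.Surjective f ↔ Module.length R W = Module.length R V := by
  constructor
  · intro h
    exact (LinearEquiv.ofBijective f ⟨hf, h⟩).length_eq.symm
  · intro h
    have h1 := Module.length_eq_add_of_exact f (LinearMap.range f).mkQ hf
      (Submodule.mkQ_surjective _) (LinearMap.exact_map_mkQ_range f)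
    rw [h] at h1 hW
    have h2 : Module.length R (W ⧸ LinearMap.range f) = 0 :=
      ENat.add_right_injective_of_ne_top hW (by simpa using h1.symm)
    rw [Module.length_eq_zero_iff, Submodule.Quotient.subsingleton_iff] at h2
    exact LinearMap.range_eq_top.mp h2

/-- Multiplication by `z ∈ I`, as a map `R ⧸ I → I ⧸ z I`. -/
def mulQuotient {R : Type*} [CommRing R] {z : R} {I : Ideal R} (hzI : z ∈ I) :
    (R ⧸ I) →ₗ[R] QuotSMulTop z I :=
  I.liftQ (LinearMap.toSpanSingleton R _ (Submodule.Quotient.mk ⟨z, hzI⟩)) fun r hr => by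
    rw [LinearMap.mem_ker, LinearMap.toSpanSingleton_apply, ← Submodule.Quotient.mk_smul,
      Submodule.Quotient.mk_eq_zero, Submodule.mem_smul_pointwise_iff_exists]
    exact ⟨⟨r, hr⟩, Submodule.mem_top, Subtype.ext (mul_comm z r)⟩

theorem mulQuotient_mk {R : Type*} [CommRing R] {z : R} {I : Ideal R} (hzI : z ∈ I) (r : R) :
    mulQuotient hzI (Submodule.Quotient.mk r) =
      (Submodule.Quotient.mk ⟨z * r, I.mul_mem_right r hzI⟩ : QuotSMulTop z I) := by
  change LinearMap.toSpanSingleton R (QuotSMulTop z I) (Submodule.Quotient.mk ⟨z, hzI⟩) r = _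
  rw [LinearMap.toSpanSingleton_apply, ← Submodule.Quotient.mk_smul]
  congr 1
  exact Subtype.ext (mul_comm r z)

theorem quotSMulTop_mk_eq_zero {R : Type*} [CommRing R] {z : R} {I : Ideal R} (a : I) :
    (Submodule.Quotient.mk a : QuotSMulTop z I) = 0 ↔ ∃ b ∈ I, z * b = a := by
  rw [Submodule.Quotient.mk_eq_zero, Submodule.mem_smul_pointwise_iff_exists]
  constructor
  · rintro ⟨b, -, rfl⟩
    exact ⟨b, b.2, rfl⟩
  · rintro ⟨b, hb, h⟩
    exact ⟨⟨b, hb⟩, Submodule.mem_top, Subtype.ext h⟩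

theorem mulQuotient_injective {R : Type*} [CommRing R] {z : R} (hz : z ∈ nonZeroDivisors R)
    {I : Ideal R} (hzI : z ∈ I) :
    Function.Injective (mulQuotient hzI) := by
  rw [injective_iff_map_eq_zero]
  intro r hr
  obtain ⟨r, rfl⟩ := Submodule.Quotient.mk_surjective I r
  rw [mulQuotient_mk, quotSMulTop_mk_eq_zero] at hr
  obtain ⟨b, hb, h⟩ := hr
  rw [mul_cancel_left_mem_nonZeroDivisors hz] at h
  exact (Submodule.Quotient.mk_eq_zero I).mpr (h ▸ hb)

variable {R : Type u} [CommRing R] [IsLocalRing R]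

theorem IsCohenMacaulayDimOne.type_ideal (hR : IsCohenMacaulayDimOne R) {I : Ideal R}
    (hI : I ≠ ⊥) : type R I = bassNumber R I 1 := by
  rw [type, hR.dim_ideal hI]

theorem IsCohenMacaulayDimOne.type_quotient (hR : IsCohenMacaulayDimOne R) {z : R}
    (hz : z ∈ nonZeroDivisors R) {I : Ideal R} (hzI : z ∈ I) :
    type R (R ⧸ I) = bassNumber R (R ⧸ I) 0 := by
  have := hR.isArtinianRing_quotient hz hzI
  have h : Module.supportDim R (R ⧸ I) ≤ 0 := by
    rw [Module.supportDim_quotient_eq_ringKrullDim]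
    have h0 : Ring.KrullDimLE 0 (R ⧸ I) := inferInstance
    rwa [Ring.KrullDimLE, Order.krullDimLE_iff] at h0
  rw [type, show dim R (R ⧸ I) = 0 from ?_]
  rw [dim]
  generalize Module.supportDim R (R ⧸ I) = d at h
  induction d with
  | bot => rfl
  | coe d =>
    have : d = 0 := by simpa using h
    subst this; rfl

theorem compRight_mulQuotient_injective {z : R} (hz : z ∈ nonZeroDivisors R) {I : Ideal R}
    (hzI : z ∈ I) : Function.Injective
      ((mulQuotient hzI).compRight R :
        (ResidueField R →ₗ[R] R ⧸ I) →ₗ[R] (ResidueField R →ₗ[R] QuotSMulTop z I)) :=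
  fun _ _ h => LinearMap.ext fun x => mulQuotient_injective hz hzI (LinearMap.congr_fun h x)

/-- For a nonzerodivisor `z ∈ 𝔪 ∩ I`, multiplication by `z` induces an injection
`Hom(k, R ⧸ I) → Hom(k, I ⧸ z I)`. The lengths of both sides are the types of `R ⧸ I` and of `I`, so
that the types agree if and only if the injection is onto. -/
theorem IsCohenMacaulayDimOne.type_eq_iff_surjective (hR : IsCohenMacaulayDimOne R) {z : R}
    (hzm : z ∈ maximalIdeal R) (hz : z ∈ nonZeroDivisors R) {I : Ideal R} (hzI : z ∈ I) :
    type R I = type R (R ⧸ I) ↔ Function.Surjective ((mulQuotient hzI).compRight R :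
        (ResidueField R →ₗ[R] R ⧸ I) →ₗ[R] (ResidueField R →ₗ[R] QuotSMulTop z I)) := by
  have := hR.noetherian
  have hI : I ≠ ⊥ := by
    rintro rfl
    exact nonZeroDivisors.ne_zero hz (Ideal.mem_bot.mp hzI)
  have h1 := length_residueHom_quotSMulTop hzm (isSMulRegular_ideal hz I)
  rw [surjective_iff_length_eq (compRight_mulQuotient_injective hz hzI)
    (by rw [h1]; exact ENat.natCast_ne_top _), h1, length_residueHom, hR.type_ideal hI,
    hR.type_quotient hz hzI, Nat.cast_inj]

/-- The colon criterion: an `𝔪`-primary ideal `I` containing the nonzerodivisor `z` is Elias if and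
only if `z I : 𝔪 ⊆ z R`. -/
theorem IsCohenMacaulayDimOne.isElias_iff (hR : IsCohenMacaulayDimOne R) {I : Ideal R}
    (hI : IsMPrimary I) {z : R} (hz : z ∈ nonZeroDivisors R) (hzI : z ∈ I) :
    IsElias I ↔
      (Ideal.span {z} * I).colon (maximalIdeal R : Set R) ≤ Ideal.span {z} := by
  have hzm : z ∈ maximalIdeal R := le_maximalIdeal hI.ne_top hzI
  rw [IsElias, and_iff_right hI, hR.type_eq_iff_surjective hzm hz hzI]
  have hmem {a : R} (ha : a ∈ (Ideal.span {z} * I).colon (maximalIdeal R : Set R)) {r : R}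
      (hr : r ∈ maximalIdeal R) : ∃ b ∈ I, z * b = r * a := by
    rw [mul_comm r]
    exact Ideal.mem_span_singleton_mul.mp (Submodule.mem_colon.mp ha r hr)
  constructor
  · intro hsurj a ha
    have haI : a ∈ I := by
      obtain ⟨b, hb, h⟩ := hmem ha hzm
      exact (mul_cancel_left_mem_nonZeroDivisors hz).mp h ▸ hb
    obtain ⟨g, hg⟩ := hsurj (residueHom (Submodule.Quotient.mk ⟨a, haI⟩) fun r hr => by
      rw [← Submodule.Quotient.mk_smul, quotSMulTop_mk_eq_zero]
      exact hmem ha hr)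
    have h1 := LinearMap.congr_fun hg 1
    rw [LinearMap.compRight_apply, residueHom_one, LinearMap.comp_apply] at h1
    obtain ⟨c, hc⟩ := Submodule.Quotient.mk_surjective I (g 1)
    rw [← hc, mulQuotient_mk, ← sub_eq_zero, ← Submodule.Quotient.mk_sub,
      quotSMulTop_mk_eq_zero] at h1
    obtain ⟨b, -, hb⟩ := h1
    refine Ideal.mem_span_singleton'.mpr ⟨c - b, ?_⟩
    have hb' : z * b = z * c - a := hb
    linear_combination -hb'
  · intro hle f
    obtain ⟨⟨a, haI⟩, ha⟩ := Submodule.Quotient.mk_surjective _ (f 1)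
    have hra (r : R) (hr : r ∈ maximalIdeal R) : ∃ b ∈ I, z * b = r * a := by
      have h1 := smul_residueHom_one f hr
      rw [← ha, ← Submodule.Quotient.mk_smul, quotSMulTop_mk_eq_zero] at h1
      exact h1
    have haz : a ∈ Ideal.span {z} := hle <| Submodule.mem_colon.mpr fun r hr => by
      rw [smul_eq_mul, mul_comm a]
      exact Ideal.mem_span_singleton_mul.mpr (hra r hr)
    obtain ⟨c, rfl⟩ := Ideal.mem_span_singleton'.mp haz
    refine ⟨residueHom (Submodule.Quotient.mk c) fun r hr => ?_, residueHom_ext ?_⟩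
    · obtain ⟨b, hb, h⟩ := hra r hr
      rw [← Submodule.Quotient.mk_smul, Submodule.Quotient.mk_eq_zero, smul_eq_mul]
      rw [← mul_assoc, mul_comm _ z, mul_cancel_left_mem_nonZeroDivisors hz] at h
      exact h ▸ hb
    · rw [LinearMap.compRight_apply, LinearMap.comp_apply, residueHom_one, mulQuotient_mk, ← ha]
      congr 1
      exact Subtype.ext (mul_comm z c)

end EliasCriterion

/-! ### Elias ideals and canonical ideals -/

section CanonicalAndElias

variable {R : Type u} [CommRing R] [IsLocalRing R]

/-- A proper ideal `I ≅ R` is `x R` for a nonzerodivisor `x ∈ 𝔪`, and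
`x² R : 𝔪 ⊆ x² R : x = x R`. -/
theorem IsCohenMacaulayDimOne.isElias_of_equiv_self (hR : IsCohenMacaulayDimOne R) {I : Ideal R}
    (hI : I ≠ ⊤) (e : I ≃ₗ[R] R) : IsElias I := by
  set x : R := (e.symm 1).1
  have hxI : x ∈ I := (e.symm 1).2
  have hmul (r : R) : (e.symm r : R) = r * x := by
    have h : e.symm r = r • e.symm 1 := by rw [← map_smul, smul_eq_mul, mul_one]
    rw [h]; rfl
  have hx : x ∈ nonZeroDivisors R := mem_nonZeroDivisors_iff_right.mpr fun r hr => by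
    rw [← hmul] at hr
    exact e.symm.map_eq_zero_iff.mp (Subtype.ext hr)
  have hIx : I = Ideal.span {x} := by
    refine le_antisymm (fun a ha => ?_) ((Ideal.span_singleton_le_iff_mem I).mpr hxI)
    refine Ideal.mem_span_singleton'.mpr ⟨e ⟨a, ha⟩, ?_⟩
    rw [← hmul, e.symm_apply_apply]
  rw [hR.isElias_iff (hR.isMPrimary_of_mem hx hxI hI) hx hxI]
  intro a ha
  have h := Submodule.mem_colon.mp ha x (le_maximalIdeal hI hxI)
  obtain ⟨b, hb, hab⟩ := Ideal.mem_span_singleton_mul.mp h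
  rw [smul_eq_mul, mul_comm a, mul_cancel_left_mem_nonZeroDivisors hx] at hab
  rw [← hab]
  exact hIx ▸ hb

/-- A nonzerodivisor `z ∈ J` can be used in the colon criterion for both ideals, and
`z J : 𝔪 ⊆ z I : 𝔪`. -/
theorem IsElias.of_le (hR : IsCohenMacaulayDimOne R) {I J : Ideal R} (hI : IsElias I) (hJI : J ≤ I)
    (hJ : IsMPrimary J) : IsElias J := by
  obtain ⟨z, hzJ, hz⟩ := hR.exists_mem_nonZeroDivisors_of_isMPrimary hJ
  rw [hR.isElias_iff hJ hz hzJ]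
  exact (Submodule.colon_mono (Ideal.mul_mono_right hJI) le_rfl).trans
    ((hR.isElias_iff hI.1 hz (hJI hzJ)).mp hI)

/-- A proper canonical ideal `K` is Elias: `type (R ⧸ K)` is nonzero and at most `type K = 1`. -/
theorem IsCanonicalIdeal.isElias (hR : IsCohenMacaulayDimOne R) {K : Ideal R}
    (hK : IsCanonicalIdeal K) (hne : K ≠ ⊤) : IsElias K := by
  have := hR.noetherian
  obtain ⟨z, hzK, hz⟩ := hK.exists_mem_nonZeroDivisors hR
  have hzm : z ∈ maximalIdeal R := le_maximalIdeal hne hzK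
  refine ⟨hR.isMPrimary_of_mem hz hzK hne, ?_⟩
  have hinj := Module.length_le_of_injective _ (compRight_mulQuotient_injective hz hzK)
  rw [length_residueHom_quotSMulTop hzm (isSMulRegular_ideal hz K), length_residueHom,
    hK.bassNumber_one hR, Nat.cast_le] at hinj
  have : Nontrivial (R ⧸ K) := Ideal.Quotient.nontrivial_iff.mpr hne
  obtain ⟨a, ha0, ha⟩ := exists_socle_of_isFiniteLength (hR.isFiniteLength_quotient hz hzK)
  have hnt : Nontrivial (ResidueField R →ₗ[R] R ⧸ K) :=
    ⟨residueHom a ha, 0, fun h => ha0 (by rw [← residueHom_one a ha, h, LinearMap.zero_apply])⟩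
  have hpos := Module.length_pos (R := R) (M := ResidueField R →ₗ[R] R ⧸ K)
  rw [length_residueHom, Nat.cast_pos] at hpos
  rw [hK.2.1, hR.type_quotient hz hzK]
  omega

/-- The double colon `K : (K : I)` by a canonical ideal `K ⊆ I` is `I`. -/
theorem IsCanonicalIdeal.colon_colon_of_le (hR : IsCohenMacaulayDimOne R) {K I : Ideal R}
    (hK : IsCanonicalIdeal K) (hKI : K ≤ I) : K.colon (K.colon (I : Set R) : Set R) = I := by
  obtain ⟨z, hzK, hz⟩ := hK.exists_mem_nonZeroDivisors hR
  refine le_antisymm (fun a ha => ?_) fun a ha => Submodule.mem_colon.mpr fun c hc => by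
    rw [smul_eq_mul, mul_comm]; exact Submodule.mem_colon.mp hc a ha
  rw [← hK.colon_colon hR hz (hKI hzK)]
  refine Submodule.mem_colon.mpr fun c hc => ?_
  -- elements of `z K : I` are multiples of `z`, because `z K : K = z R`
  have hcz : c ∈ Ideal.span {z} := by
    rw [← hK.span_singleton_mul_colon_self hR hz]
    exact Submodule.colon_mono le_rfl hKI hc
  obtain ⟨d, rfl⟩ := Ideal.mem_span_singleton'.mp hcz
  have hd : d ∈ K.colon (I : Set R) := Submodule.mem_colon.mpr fun y hy => by
    obtain ⟨w, hw, h⟩ := Ideal.mem_span_singleton_mul.mp (Submodule.mem_colon.mp hc y hy)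
    rw [smul_eq_mul, mul_comm d, mul_assoc, mul_cancel_left_mem_nonZeroDivisors hz] at h
    rw [smul_eq_mul, ← h]
    exact hw
  refine Ideal.mem_span_singleton_mul.mpr ⟨a * d, Submodule.mem_colon.mp ha d hd, ?_⟩
  rw [smul_eq_mul]; ring

/-- For a nonzerodivisor `y ∈ 𝔪 K` and `L = y K`, the colon criterion reads `L : 𝔪 (K : I) ⊆ L : K`,
and duality turns this into `K ⊆ 𝔪 (K : I)`. -/
theorem IsCanonicalIdeal.isElias_iff (hR : IsCohenMacaulayDimOne R) {K I : Ideal R}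
    (hK : IsCanonicalIdeal K) (hKI : K ≤ I) :
    IsElias I ↔ K ≤ maximalIdeal R * K.colon (I : Set R) := by
  have := hR.noetherian
  obtain ⟨w, hwm, hw⟩ := hR.exists_mem_nonZeroDivisors
  obtain ⟨v, hvK, hv⟩ := hK.exists_mem_nonZeroDivisors hR
  obtain rfl | hI := eq_or_ne I ⊤
  · -- both sides fail for `I = R`, the right-hand one by Nakayama's lemma
    refine iff_of_false (fun h => h.1.ne_top rfl) fun h => hK.ne_bot ?_
    refine Submodule.eq_bot_of_le_smul_of_le_jacobson_bot (maximalIdeal R) K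
      (IsNoetherian.noetherian K) (h.trans ?_) (by rw [jacobson_eq_maximalIdeal _ bot_ne_top])
    refine Ideal.mul_mono_right fun a ha => ?_
    simpa using Submodule.mem_colon.mp ha 1 trivial
  -- `y` lies in `𝔪 K`, so that duality with respect to `L = y K` applies to `I`, `K`, `𝔪 (K : I)`
  set y := w * v
  have hy : y ∈ nonZeroDivisors R := mul_mem hw hv
  have hyK : y ∈ K := K.mul_mem_left w hvK
  have hKc : K ≤ K.colon (I : Set R) := fun a ha =>
    Submodule.mem_colon.mpr fun r _ => K.mul_mem_right r ha
  set D := maximalIdeal R * K.colon (I : Set R)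
  have hyD : y ∈ D := Ideal.mul_mem_mul hwm (hKc hvK)
  set L := Ideal.span {y} * K
  have hLK : L.colon (K : Set R) = Ideal.span {y} := hK.span_singleton_mul_colon_self hR hy
  have key : (Ideal.span {y} * I).colon (maximalIdeal R : Set R) = L.colon (D : Set R) := by
    refine le_antisymm (fun a ha => ?_) fun a ha => ?_
    · have h : Ideal.span {a} * D ≤ L := by
        rw [← mul_assoc, Ideal.mul_le]
        intro s hs c hc
        have hs' : s ∈ Ideal.span {y} * I := by
          refine (Ideal.mul_le.mpr ?_ : Ideal.span {a} * maximalIdeal R ≤ _) hs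
          intro t ht r hr
          obtain ⟨q, rfl⟩ := Ideal.mem_span_singleton'.mp ht
          rw [mul_assoc]
          exact Ideal.mul_mem_left _ q (Submodule.mem_colon.mp ha r hr)
        obtain ⟨b, hb, rfl⟩ := Ideal.mem_span_singleton_mul.mp hs'
        exact Ideal.mem_span_singleton_mul.mpr
          ⟨b * c, by rw [mul_comm]; exact Submodule.mem_colon.mp hc b hb, by ring⟩
      exact Submodule.mem_colon.mpr fun d hd =>
        h (Ideal.mul_mem_mul (Ideal.mem_span_singleton_self a) hd)
    · refine Submodule.mem_colon.mpr fun r hr => ?_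
      have har (c : R) (hc : c ∈ K.colon (I : Set R)) : a * r * c ∈ L := by
        rw [mul_assoc]
        exact Submodule.mem_colon.mp ha (r * c) (Ideal.mul_mem_mul hr hc)
      have hmem : a * r ∈ Ideal.span {y} := by
        rw [← hLK]
        exact Submodule.mem_colon.mpr fun c hc => har c (hKc hc)
      obtain ⟨b, hb⟩ := Ideal.mem_span_singleton'.mp hmem
      refine Ideal.mem_span_singleton_mul.mpr ⟨b, ?_, by rw [smul_eq_mul, ← hb, mul_comm]⟩
      rw [← hK.colon_colon_of_le hR hKI]
      refine Submodule.mem_colon.mpr fun c hc => ?_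
      obtain ⟨q, hq, h⟩ := Ideal.mem_span_singleton_mul.mp (har c hc)
      rw [← hb, mul_comm b, mul_assoc y, mul_cancel_left_mem_nonZeroDivisors hy] at h
      rw [smul_eq_mul, ← h]
      exact hq
  rw [hR.isElias_iff (hR.isMPrimary_of_mem hy (hKI hyK) hI) hy (hKI hyK), key, ← hLK]
  refine ⟨fun h => ?_, fun h => Submodule.colon_mono le_rfl h⟩
  calc
    K = L.colon (L.colon (K : Set R) : Set R) := (hK.colon_colon hR hy hyK).symm
    _ ≤ L.colon (L.colon (D : Set R) : Set R) := Submodule.colon_mono le_rfl h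
    _ = D := hK.colon_colon hR hy hyD

theorem IsCanonicalIdeal.isElias_colon_iff (hR : IsCohenMacaulayDimOne R) {K I : Ideal R}
    (hK : IsCanonicalIdeal K) (hKI : K ≤ I) :
    IsElias (K.colon (I : Set R)) ↔ K ≤ maximalIdeal R * I := by
  rw [hK.isElias_iff hR fun a ha => Submodule.mem_colon.mpr fun r _ => K.mul_mem_right r ha,
    hK.colon_colon_of_le hR hKI]

theorem le_maximalIdeal_of_idealOrder_eq_one {K : Ideal R} (h : idealOrder K = 1) :
    K ≤ maximalIdeal R := by
  intro x hx
  by_contra hxm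
  have h1 : elementOrder x ≤ 0 := iSup₂_le fun a ha => by
    obtain _ | a := a
    · exact le_rfl
    · exact absurd (Ideal.pow_le_self a.succ_ne_zero ha) hxm
  have h2 : idealOrder K ≤ elementOrder x := iInf₂_le x hx
  rw [h] at h2
  exact absurd (h2.trans h1) (by decide)

theorem not_le_maximalIdeal_sq_of_idealOrder_eq_one {K : Ideal R} (h : idealOrder K = 1) :
    ¬ K ≤ maximalIdeal R ^ 2 := by
  intro hle
  have h1 : (2 : ℕ∞) ≤ idealOrder K := le_iInf₂ fun x hx =>
    le_iSup₂ (f := fun (a : ℕ) (_ : x ∈ maximalIdeal R ^ a) => (a : ℕ∞)) 2 (hle hx)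
  rw [h] at h1
  exact absurd h1 (by decide)

theorem IsCanonicalIdeal.isElias_iff_eq (hR : IsCohenMacaulayDimOne R) {K I : Ideal R}
    (hK : IsCanonicalIdeal K) (hKI : K ≤ I) (h1 : idealOrder K = 1) : IsElias I ↔ I = K := by
  constructor
  · intro hI
    by_contra hne
    have hle := (hK.isElias_iff hR hKI).mp hI
    refine not_le_maximalIdeal_sq_of_idealOrder_eq_one h1 (hle.trans ?_)
    rw [pow_two]
    refine Ideal.mul_mono_right (le_maximalIdeal fun htop => hne (le_antisymm (fun a ha => ?_) hKI))
    have h : (1 : R) ∈ K.colon (I : Set R) := htop ▸ Submodule.mem_top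
    simpa using Submodule.mem_colon.mp h a ha
  · rintro rfl
    refine hK.isElias hR fun htop => ?_
    have := le_maximalIdeal_of_idealOrder_eq_one h1
    exact (maximalIdeal.isMaximal R).ne_top (top_le_iff.mp (htop ▸ this))

end CanonicalAndElias

end EliasIdeals

theorem corollary1p3 {R : Type u} [CommRing R] [IsLocalRing R]
    (hR : EliasIdeals.IsCohenMacaulayDimOne R) :
    -- proper ideals isomorphic to `R` or to a canonical module are Elias
    ((∀ I : Ideal R, I ≠ ⊤ → Nonempty (I ≃ₗ[R] R) → EliasIdeals.IsElias I) ∧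
      (∀ (ω : Type u) [AddCommGroup ω] [Module R ω], EliasIdeals.IsCanonicalModule R ω →
        ∀ I : Ideal R, I ≠ ⊤ → Nonempty (I ≃ₗ[R] ω) → EliasIdeals.IsElias I)) ∧
    -- being Elias passes to smaller `𝔪`-primary ideals
    (∀ I J : Ideal R, EliasIdeals.IsElias I → J ≤ I → EliasIdeals.IsMPrimary J →
      EliasIdeals.IsElias J) ∧
    -- for a canonical ideal `K ⊆ I`: `I` is Elias iff `K ⊆ 𝔪 (K : I)`
    (∀ K I : Ideal R, EliasIdeals.IsCanonicalIdeal K → K ≤ I →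
      (EliasIdeals.IsElias I ↔
        K ≤ IsLocalRing.maximalIdeal R * Submodule.colon K (I : Set R))) ∧
    -- for a canonical ideal `K ⊆ I`: `K : I` is Elias iff `K ⊆ 𝔪 I`
    (∀ K I : Ideal R, EliasIdeals.IsCanonicalIdeal K → K ≤ I →
      (EliasIdeals.IsElias (Submodule.colon K (I : Set R)) ↔
        K ≤ IsLocalRing.maximalIdeal R * I)) ∧
    -- for a canonical ideal `K ⊆ I` of order one: `I` is Elias iff `I = K`
    (∀ K I : Ideal R, EliasIdeals.IsCanonicalIdeal K → K ≤ I → EliasIdeals.idealOrder K = 1 →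
      (EliasIdeals.IsElias I ↔ I = K)) := by
  refine ⟨⟨fun I hI ⟨e⟩ => hR.isElias_of_equiv_self hI e, fun ω _ _ hω I hI ⟨e⟩ => ?_⟩,
    fun I J hI hJI hJ => hI.of_le hR hJI hJ, fun K I hK hKI => hK.isElias_iff hR hKI,
    fun K I hK hKI => hK.isElias_colon_iff hR hKI,
    fun K I hK hKI h => hK.isElias_iff_eq hR hKI h⟩
  exact EliasIdeals.IsCanonicalIdeal.isElias hR (hω.congr e.symm) hI
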